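/- Let $N$ be a finite set of agents and $\mathcal S$ a set of outcomes; agent $i$ has a private type $t_i$ in a domain $D_i$, type $t_i$ has cost $t_i(X)\in\mathbb R$ for outcome $X$, and her utility from $X$ with payment $p_i$ is $p_i-t_i(X)$. (The single-parameter setting is the special case $D_i\subseteq\mathbb R$, $t_i(X)=t_i\,w_i(X)$ with $w_i$ public.) Let $f:\prod_i D_i\to\mathcal S$ and $k\in\{0,1,2,\dots\}\cup\{\infty\}$. **General mechanisms.** An extensive-form mechanism is a finite extensive-form game with perfect recall, possibly with imperfect information and with random moves (of positive probability) of the mechanism, whose terminal histories carry an outcome and a payment to each agent, together with a strategy $S_i(t_i)$ (an available action at each information set of $i$) for each agent $i$ and type $t_i\in D_i$. An information set $I$ of $i$ is an *earliest point of departure* between strategies $S_i,S_i'$ of $i$ if $I$ is on the path of play under both (for some behaviour of the others and of the mechanism), $S_i,S_i'$ agree at all information sets of $i$ earlier than $I$, and they differ at $I$. For type $t_i$, $S_i$ *$k$-step obviously dominates* $S_i'$ if at every such $I$ every utility that $i$ can obtain from $I$ by following $S_i$ at $I$ and at her next $k$ moves is at least every utility that she can obtain from $I$ by following $S_i'$ at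 $I$ and at her next $k$ moves, where the moves of the other agents, the random moves, and the moves of $i$ after those $k$ moves are arbitrary. The mechanism is a $k$-step OSP mechanism implementing $f$ if each $S_i(t_i)$ $k$-step obviously dominates, for type $t_i$, all other strategies of $i$ and, for every type profile $t$ and all realizations of the random moves, the play of $(S_i(t_i))_i$ ends with outcome $f(t)$. **Round-table mechanisms.** A round-table mechanism is a finite rooted tree whose leaves carry an outcome and a payment to each agent; at each internal node $u$ an agent $i=i(u)$ is queried, and the query partitions her current domain $D_i(u)$ (initially $D_i$) into at least two nonempty subdomains, one for each child of $u$, the current domains of the other agents being unchanged. A type profile $b$ is available at $u$ if $b\in\prod_j D_j(u)$; $\mathcal M(b)$ is the outcome with payments at the unique leaf at which $b$ is available. Two profiles diverge at $u$ if they are available at two different children of $u$. For $u$ with $i=i(u)$, on each path from $u$ to a leaf mark the $k$-th node after $u$ at which $i$ is queried ($u$ itself if $k=0$), or the leaf if there are fewer than $k$ such nodes; the $k$-step neighborhood of $u$ consists of the nodes on the paths from $u$ to marked nodes, endpoints included. For $a$ available at $u$ let $\Gamma_u^k(a)$ be the set of profiles $b$ available at $u$ that do not diverge from $a$ at any node of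 this neighborhood. The mechanism is $k$-step OSP if for every internal node $u$ with $i=i(u)$, all profiles $a$ available at $u$, all $b\in\Gamma_u^k(a)$ and all $c$ that diverge from $a$ at $u$, the utility of $i$ with type $a_i$ from $\mathcal M(b)$ is at least her utility with type $a_i$ from $\mathcal M(c)$. It implements $f$ if the outcome of $\mathcal M(b)$ is $f(b)$ for every profile $b$. **Theorem.** There is a $k$-step OSP extensive-form mechanism implementing $f$ if and only if there is a $k$-step OSP round-table mechanism implementing $f$. -/

import Mathlib

/-! Agents form a type `N`, the type domain of agent `i` is `D i`, outcomes form a type `S`. -/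

namespace OSP

/-! ### General extensive-form games and mechanisms -/

/-- Finite extensive-form game trees.
* `terminal X p`: the game ends with outcome `X` and payments `p`.
* `decision i I m next`: agent `i`, at (a history belonging to) her information set `I`, chooses
  one of the `m` actions `0, …, m - 1`; action `a` leads to `next a`.
* `chance m w next`: the mechanism moves at random, choosing `a` with probability `w a`.

The information sets of agent `i` are indexed by natural numbers; the information sets of
different agents are unrelated, even if they carry the same index. -/
inductive GameTree (N : Type*) (S : Type*) where
  | terminal (X : S) (p : N → ℝ) : GameTree N S
  | decision (i : N) (I : ℕ) (m : ℕ) (next : Fin m → GameTree N S) : GameTree N S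
  | chance (m : ℕ) (w : Fin m → ℝ) (next : Fin m → GameTree N S) : GameTree N S

namespace GameTree

variable {N : Type*} {S : Type*}

/-- The subtree reached after the history (sequence of moves) `h`; `none` if `h` is not a history
of the game. -/
def sub : GameTree N S → List ℕ → Option (GameTree N S)
  | G, [] => some G
  | terminal _ _, _ :: _ => none
  | decision _ _ m next, a :: h => if ha : a < m then (next ⟨a, ha⟩).sub h else none
  | chance m _ next, a :: h => if ha : a < m then (next ⟨a, ha⟩).sub h else none

/-- Agent `i` moves at the history `h`, which belongs to her information set `I`. -/
def InInfoSet (G : GameTree N S) (i : N) (I : ℕ) (h : List ℕ) : Prop :=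
  ∃ m next, G.sub h = some (decision i I m next)

open Classical in
/-- The record of agent `i` along the history `h`: the sequence of her information sets met at
proper subhistories of `h`, each with the action she took there. -/
noncomputable def record (i : N) : GameTree N S → List ℕ → List (ℕ × ℕ)
  | _, [] => []
  | terminal _ _, _ :: _ => []
  | decision j I m next, a :: h =>
      (if j = i then [(I, a)] else []) ++ (if ha : a < m then record i (next ⟨a, ha⟩) h else [])
  | chance m _ next, a :: h => if ha : a < m then record i (next ⟨a, ha⟩) h else []

/-- Perfect recall: an agent has the same record at all histories of an information set. -/
def PerfectRecall (G : GameTree N S) : Prop :=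
  ∀ i I h h', G.InInfoSet i I h → G.InInfoSet i I h' → record i G h = record i G h'

/-- Well-formed extensive-form games with perfect recall: there is an action at every decision
history, random moves have positive probabilities with sum one, the same actions are available at
all histories of an information set, and perfect recall holds. -/
structure IsGame (G : GameTree N S) : Prop where
  action_exists : ∀ h i I m next, G.sub h = some (decision i I m next) → 0 < m
  prob_pos : ∀ h m w next, G.sub h = some (chance m w next) → ∀ a, 0 < w a
  prob_sum : ∀ h m w next, G.sub h = some (chance m w next) → ∑ a, w a = 1
  same_actions : ∀ h h' i I m m' next next', G.sub h = some (decision i I m next) →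
    G.sub h' = some (decision i I m' next') → m = m'
  perfect_recall : G.PerfectRecall

/-- `σ`, a function from information sets to actions, is a strategy of agent `i`: the action
chosen at each of her information sets is available there. -/
def IsStrategy (G : GameTree N S) (i : N) (σ : ℕ → ℕ) : Prop :=
  ∀ h I m next, G.sub h = some (decision i I m next) → σ I < m

/-- All moves of agent `i` along the history `h` are those of the strategy `σ`. -/
def Follows (G : GameTree N S) (i : N) (σ : ℕ → ℕ) (h : List ℕ) : Prop :=
  ∀ g a I, g ++ [a] <+: h → G.InInfoSet i I g → a = σ I

/-- The information set `I` of agent `i` is on the path of play under `σ` (for some behaviour of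
the other agents and of the mechanism). -/
def OnPath (G : GameTree N S) (i : N) (σ : ℕ → ℕ) (I : ℕ) : Prop :=
  ∃ h, G.InInfoSet i I h ∧ G.Follows i σ h

/-- The information set `J` of agent `i` is earlier than her information set `I`. -/
def Earlier (G : GameTree N S) (i : N) (J I : ℕ) : Prop :=
  ∃ g h, G.InInfoSet i J g ∧ G.InInfoSet i I h ∧ g <+: h ∧ g ≠ h

/-- `I` is an earliest point of departure between the strategies `σ` and `σ'` of agent `i`. -/
def EarliestDeparture (G : GameTree N S) (i : N) (σ σ' : ℕ → ℕ) (I : ℕ) : Prop :=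
  G.OnPath i σ I ∧ G.OnPath i σ' I ∧ (∀ J, G.Earlier i J I → σ J = σ' J) ∧ σ I ≠ σ' I

open Classical in
/-- The pairs (outcome, payments) that can be reached in the tree when agent `i` follows `σ` in
her first `k` moves and anything may happen otherwise: arbitrary moves of the other agents and of
the mechanism, and arbitrary moves of `i` from her `(k+1)`-st move on. -/
def outcomes (i : N) (σ : ℕ → ℕ) : ℕ∞ → GameTree N S → Set (S × (N → ℝ))
  | _, terminal X p => {(X, p)}
  | k, decision j I m next =>
      {o | ∃ a : Fin m, (j = i → k ≠ 0 → (a : ℕ) = σ I) ∧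
        o ∈ outcomes i σ (if j = i then k - 1 else k) (next a)}
  | k, chance _ _ next => {o | ∃ a, o ∈ outcomes i σ k (next a)}

/-- The pairs (outcome, payments) reachable from the information set `I` when `i` follows `σ` at
`I` and at her next `k` moves after `I`. -/
def outcomesFrom (G : GameTree N S) (i : N) (σ : ℕ → ℕ) (k : ℕ∞) (I : ℕ) :
    Set (S × (N → ℝ)) :=
  {o | ∃ (h : List ℕ) (m : ℕ) (next : Fin m → GameTree N S) (a : Fin m),
    G.sub h = some (decision i I m next) ∧ (a : ℕ) = σ I ∧ o ∈ outcomes i σ k (next a)}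

/-- For an agent `i` with cost function `c`, the strategy `σ` `k`-step obviously dominates `σ'`:
at every earliest point of departure, the best that can happen with `σ'` is weakly worse than the
worst that can happen with `σ`. -/
def KStepObviouslyDominates (G : GameTree N S) (i : N) (c : S → ℝ) (k : ℕ∞)
    (σ σ' : ℕ → ℕ) : Prop :=
  ∀ I, G.EarliestDeparture i σ σ' I →
    ∀ o ∈ G.outcomesFrom i σ k I, ∀ o' ∈ G.outcomesFrom i σ' k I,
      o'.2 i - c o'.1 ≤ o.2 i - c o.1

/-- The pairs (outcome, payments) that result, over all realizations of the random moves of the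
mechanism, when the agents play the strategy profile `σ`. -/
def plays (σ : N → ℕ → ℕ) : GameTree N S → Set (S × (N → ℝ))
  | terminal X p => {(X, p)}
  | decision j I m next => {o | ∃ a : Fin m, (a : ℕ) = σ j I ∧ o ∈ plays σ (next a)}
  | chance _ _ next => {o | ∃ a, o ∈ plays σ (next a)}

end GameTree

/-- An extensive-form mechanism: an extensive-form game with perfect recall, together with a
strategy of every agent for each of her types. -/
structure Mechanism (N : Type*) (D : N → Type*) (S : Type*) where
  game : GameTree N S
  isGame : game.IsGame
  strategy : ∀ i, D i → ℕ → ℕ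
  isStrategy : ∀ i t, game.IsStrategy i (strategy i t)

namespace Mechanism

variable {N : Type*} {D : N → Type*} {S : Type*}

/-- The mechanism selects `f t` for every type profile `t`, whatever its random choices. -/
def Implements (M : Mechanism N D S) (f : (∀ i, D i) → S) : Prop :=
  ∀ t : ∀ i, D i, ∀ o ∈ M.game.plays (fun i => M.strategy i (t i)), o.1 = f t

/-- For each type of each agent, the strategy prescribed by the mechanism `k`-step obviously
dominates every other strategy. Here `cost i t X` is the cost of `X` for agent `i` of type `t`. -/
def KStepOSP (M : Mechanism N D S) (cost : ∀ i, D i → S → ℝ) (k : ℕ∞) : Prop :=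
  ∀ i t σ', M.game.IsStrategy i σ' →
    M.game.KStepObviouslyDominates i (cost i t) k (M.strategy i t) σ'

end Mechanism

/-! ### Round-table mechanisms -/

/-- Implementation trees. `leaf X p` is a leaf with outcome `X` and payments `p`; at
`query i m part child` agent `i` is queried, and her answer `a` signals that her type belongs to
the subdomain `part a` and leads to `child a`. -/
inductive QueryTree (N : Type*) (D : N → Type*) (S : Type*) where
  | leaf (X : S) (p : N → ℝ) : QueryTree N D S
  | query (i : N) (m : ℕ) (part : Fin m → Set (D i)) (child : Fin m → QueryTree N D S) :
      QueryTree N D S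

namespace QueryTree

variable {N : Type*} {D : N → Type*} {S : Type*}

open Classical in
/-- Every query of the tree partitions the current domain of the queried agent into at least two
(nonempty) subdomains; `E i` is the current domain of agent `i` at the root of the tree. -/
def IsRoundTableOn : (∀ i, Set (D i)) → QueryTree N D S → Prop
  | _, leaf _ _ => True
  | E, query i m part child =>
      2 ≤ m ∧ (∀ a, (part a).Nonempty) ∧ (∀ a b, a ≠ b → Disjoint (part a) (part b)) ∧
      (⋃ a, part a) = E i ∧ ∀ a, IsRoundTableOn (Function.update E i (part a)) (child a)

/-- The tree is that of a round-table mechanism for the full type domains. -/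
def IsRoundTable (T : QueryTree N D S) : Prop := T.IsRoundTableOn (fun _ => Set.univ)

/-- The subtree at the node `u`, a node being the sequence of answers that leads to it; `none` if
there is no such node. -/
def sub : QueryTree N D S → List ℕ → Option (QueryTree N D S)
  | T, [] => some T
  | leaf _ _, _ :: _ => none
  | query _ m _ child, a :: u => if ha : a < m then (child ⟨a, ha⟩).sub u else none

/-- `u` is a node at which agent `i` is queried. -/
def Queried (T : QueryTree N D S) (i : N) (u : List ℕ) : Prop :=
  ∃ m part child, T.sub u = some (query i m part child)

/-- `u` is a leaf. -/
def IsLeaf (T : QueryTree N D S) (u : List ℕ) : Prop := ∃ X p, T.sub u = some (leaf X p)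

/-- The type profile `b` is compatible with (available at) the node `u`. -/
def Available (b : ∀ i, D i) : QueryTree N D S → List ℕ → Prop
  | _, [] => True
  | leaf _ _, _ :: _ => False
  | query i m part child, a :: u =>
      ∃ ha : a < m, b i ∈ part ⟨a, ha⟩ ∧ Available b (child ⟨a, ha⟩) u

/-- The mechanism ends with outcome `X` and payments `p` on the type profile `b`. -/
def Result (T : QueryTree N D S) (b : ∀ i, D i) (X : S) (p : N → ℝ) : Prop :=
  ∃ u, T.sub u = some (leaf X p) ∧ T.Available b u

/-- The profiles `a` and `b` diverge (are separated) at the node `u`: they are available at two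
different children of `u`. -/
def Diverge (T : QueryTree N D S) (u : List ℕ) (a b : ∀ i, D i) : Prop :=
  ∃ x y, x ≠ y ∧ T.Available a (u ++ [x]) ∧ T.Available b (u ++ [y])

/-- The number of nodes on the path from `u` (excluded) to `v` (included) at which agent `i` is
queried. -/
noncomputable def numQueries (T : QueryTree N D S) (i : N) (u v : List ℕ) : ℕ :=
  Set.ncard {w | u <+: w ∧ u ≠ w ∧ w <+: v ∧ T.Queried i w}

/-- `v` belongs to the `k`-step limit of the node `u`, at which `i` is queried: on a path from `u`
to a leaf, `v` is the `k`-th node after `u` at which `i` is queried, or it is the leaf if `i` is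
queried fewer than `k` times after `u`. -/
def InLimit (T : QueryTree N D S) (i : N) (k : ℕ∞) (u v : List ℕ) : Prop :=
  u <+: v ∧ ((T.Queried i v ∧ (T.numQueries i u v : ℕ∞) = k) ∨
    (T.IsLeaf v ∧ (T.numQueries i u v : ℕ∞) < k))

/-- `v` belongs to the `k`-step neighborhood of the node `u`, at which `i` is queried. -/
def InNeighborhood (T : QueryTree N D S) (i : N) (k : ℕ∞) (u v : List ℕ) : Prop :=
  ∃ v', T.InLimit i k u v' ∧ u <+: v ∧ v <+: v'

/-- The `k`-step equivalence class, at the node `u` at which `i` is queried, of a profile `a`: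
the profiles available at `u` that are not separated from `a` in the `k`-step neighborhood
of `u` (to which `u` itself belongs). -/
def equivClass (T : QueryTree N D S) (i : N) (k : ℕ∞) (u : List ℕ) (a : ∀ i, D i) :
    Set (∀ i, D i) :=
  {b | T.Available b u ∧ ¬ T.Diverge u a b ∧ ∀ v, T.InNeighborhood i k u v → ¬ T.Diverge v a b}

/-- The round-table mechanism selects `f b` for every type profile `b`. -/
def Implements (T : QueryTree N D S) (f : (∀ i, D i) → S) : Prop :=
  ∀ b, ∃ p, T.Result b (f b) p

/-- `k`-step OSP for round-table mechanisms. The true type of agent `i` is `a i`. -/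
def KStepOSP (T : QueryTree N D S) (cost : ∀ i, D i → S → ℝ) (k : ℕ∞) : Prop :=
  ∀ i u, T.Queried i u → ∀ a b c : ∀ i, D i,
    T.Available a u → b ∈ T.equivClass i k u a → T.Diverge u a c →
    ∀ X p X' p', T.Result b X p → T.Result c X' p' →
      p' i - cost i (a i) X' ≤ p i - cost i (a i) X

end QueryTree

end OSP

namespace OSP

section

open Classical

variable {N : Type*} {D : N → Type*} {S : Type*}

/-! ### Histories, records and reachable outcomes of games -/

namespace GameTree

/-! From a game to a tree (`Simulates`): freeze every random move, and at each decision ask which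
action the strategy prescribes, unless all current types agree on it. Freezing is harmless, since
implementation and domination range over all realizations. Suppose `a` and `c` are separated at a
query of `i`. The strategies of `a i` and `c i` both reach the corresponding information set and
differ there; by perfect recall every earlier information set lies on the common history, where both
took the same action. So this is an earliest point of departure. The result of `c` is a play of the
deviating strategy. The result of a profile `b` not separated from `a` is compatible with `k + 1`
moves of the strategy of `a i` (`Simulates.mem_outcomes`): a skipped decision uses up a move of the
game but no query of the tree, so the neighborhood in the tree reaches at least as far as the next
`k` moves in the game.

From a tree to a game: play the tree with perfect information and truthful answers (`toMechanism`).
An outcome reachable by answering as type `t` for `k + 1` moves is the result of a profile `b` whose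
`i`-th type need not be `t`, as later moves are arbitrary. Replacing that type by `t` gives a
profile `a` not separated from `b` in the neighborhood (`IsRoundTableOn.exists_profile`), and the
condition on the tree applies to `a`, `b` and any `c` that gives the deviating answer.

Both directions express the neighborhood of a node as a budget: the nodes before which `i` has been
queried fewer than `k + 1` times, the node itself included (`queriesBefore`).

If some domain is empty there are no profiles, and a game or tree without moves suffices. -/

theorem follows_nil (G : GameTree N S) (i : N) (σ : ℕ → ℕ) : G.Follows i σ [] := by
  intro g a I hg
  simp at hg

theorem follows_cons {G G' : GameTree N S} {i : N} {σ : ℕ → ℕ} {x : ℕ} {h : List ℕ}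
    (hsub : ∀ g, G.sub (x :: g) = G'.sub g) (hx : ∀ I, G.InInfoSet i I [] → x = σ I)
    (hf : G'.Follows i σ h) : G.Follows i σ (x :: h) := by
  intro g a I hg hI
  cases g with
  | nil =>
    obtain ⟨rfl, -⟩ := List.cons_prefix_cons.1 hg
    exact hx I hI
  | cons y g =>
    obtain ⟨rfl, hg'⟩ := List.cons_prefix_cons.1 hg
    refine hf g a I hg' ?_
    obtain ⟨m, next, h1⟩ := hI
    exact ⟨m, next, by rw [← hsub, h1]⟩

theorem Follows.tail {G G' : GameTree N S} {i : N} {σ : ℕ → ℕ} {x : ℕ} {h : List ℕ}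
    (hsub : ∀ g, G.sub (x :: g) = G'.sub g) (hf : G.Follows i σ (x :: h)) :
    G'.Follows i σ h := by
  rintro g a I hg ⟨m, next, hI⟩
  exact hf (x :: g) a I (List.cons_prefix_cons.2 ⟨rfl, hg⟩) ⟨m, next, by rw [hsub, hI]⟩

theorem sub_decision (i : N) (I m : ℕ) (next : Fin m → GameTree N S) (a : Fin m) (h : List ℕ) :
    (decision i I m next).sub (a :: h) = (next a).sub h := by
  simp [sub]

theorem sub_chance (m : ℕ) (w : Fin m → ℝ) (next : Fin m → GameTree N S) (a : Fin m)
    (h : List ℕ) : (chance m w next).sub (a :: h) = (next a).sub h := by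
  simp [sub]

/-- Turns perfect recall, an equality of lists, into a statement about which information sets were
passed and with which actions. -/
theorem mem_record {i : N} {J x : ℕ} {h : List ℕ} : ∀ {G : GameTree N S},
    (J, x) ∈ record i G h ↔ ∃ g, g ++ [x] <+: h ∧ G.InInfoSet i J g := by
  induction h with
  | nil => intro G; cases G <;> simp [record]
  | cons y h ih =>
    intro G
    have key : (∃ g, g ++ [x] <+: y :: h ∧ G.InInfoSet i J g) ↔
        (x = y ∧ G.InInfoSet i J []) ∨ ∃ g, g ++ [x] <+: h ∧ G.InInfoSet i J (y :: g) := by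
      constructor
      · rintro ⟨g, hg, hI⟩
        cases g with
        | nil => exact Or.inl ⟨(List.cons_prefix_cons.1 hg).1, hI⟩
        | cons z g =>
          obtain ⟨rfl, hg'⟩ := List.cons_prefix_cons.1 hg
          exact Or.inr ⟨g, hg', hI⟩
      · rintro (⟨rfl, hI⟩ | ⟨g, hg, hI⟩)
        · exact ⟨[], by simp, hI⟩
        · exact ⟨y :: g, List.cons_prefix_cons.2 ⟨rfl, hg⟩, hI⟩
    rw [key]
    cases G with
    | terminal X p => simp [record, InInfoSet, sub]
    | decision j I m next =>
      by_cases hy : y < m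
      · have : ∀ g, InInfoSet (decision j I m next) i J (y :: g) ↔
            (next ⟨y, hy⟩).InInfoSet i J g := by
          intro g; simp [InInfoSet, sub, hy]
        simp only [record, hy, dif_pos, List.mem_append, ih, this]
        refine or_congr_left ?_
        by_cases hj : j = i
        · simp [hj, InInfoSet, sub]; tauto
        · simp [hj, InInfoSet, sub]
      · by_cases hj : j = i
        · simp [record, hy, hj, InInfoSet, sub]; tauto
        · simp [record, hy, hj, InInfoSet, sub]
    | chance m w next =>
      by_cases hy : y < m
      · have : ∀ g, InInfoSet (chance m w next) i J (y :: g) ↔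
            (next ⟨y, hy⟩).InInfoSet i J g := by
          intro g; simp [InInfoSet, sub, hy]
        simp only [record, hy, dif_pos, ih, this]
        simp [InInfoSet, sub]
      · simp [record, hy, InInfoSet, sub]

/-- With budget zero the strategy binds no move, so everything reachable in the tree is included. -/
theorem outcomes_subset_zero (i : N) (σ σ' : ℕ → ℕ) (G : GameTree N S) :
    ∀ (k : ℕ∞), ∀ o ∈ outcomes i σ' k G, o ∈ outcomes i σ 0 G := by
  induction G with
  | terminal X p => intro k o ho; simpa [outcomes] using ho
  | decision j I m next ih =>
    rintro k o ⟨a, -, ho⟩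
    refine ⟨a, fun _ h => absurd rfl h, ?_⟩
    have := ih a _ o ho
    simpa using this
  | chance m w next ih =>
    rintro k o ⟨a, ho⟩
    exact ⟨a, ih a _ o ho⟩

theorem plays_subset_outcomes (i : N) (σ : N → ℕ → ℕ) (G : GameTree N S) :
    ∀ (k : ℕ∞), ∀ o ∈ plays σ G, o ∈ outcomes i (σ i) k G := by
  induction G with
  | terminal X p => intro k o ho; simpa [outcomes, plays] using ho
  | decision j I m next ih =>
    rintro k o ⟨a, ha, ho⟩
    exact ⟨a, by rintro rfl _; exact ha, ih a _ o ho⟩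
  | chance m w next ih =>
    rintro k o ⟨a, ho⟩
    exact ⟨a, ih a _ o ho⟩

/-- The move at `I` itself counts as the first of `k + 1` bound moves; this also holds for `k = ⊤`.
-/
theorem mem_outcomesFrom_iff {G : GameTree N S} {i : N} {σ : ℕ → ℕ} {k : ℕ∞} {I : ℕ}
    {o : S × (N → ℝ)} : o ∈ G.outcomesFrom i σ k I ↔
      ∃ h m next, G.sub h = some (decision i I m next) ∧
        o ∈ outcomes i σ (k + 1) (decision i I m next) := by
  have hk : k + 1 - 1 = k := (ENat.addLECancellable_of_ne_top (by simp)).add_tsub_cancel_right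
  constructor
  · rintro ⟨h, m, next, a, h1, h2, h3⟩
    exact ⟨h, m, next, h1, a, fun _ _ => h2, by simpa [hk] using h3⟩
  · rintro ⟨h, m, next, h1, a, h2, h3⟩
    exact ⟨h, m, next, a, h1, h2 rfl (by simp), by simpa [hk] using h3⟩

theorem nonempty_outcome (G : GameTree N S)
    (hact : ∀ h i I m next, G.sub h = some (decision i I m next) → 0 < m)
    (hch : ∀ h m w next, G.sub h = some (chance m w next) → 0 < m) : Nonempty S := by
  induction G with
  | terminal X p => exact ⟨X⟩
  | decision j I m next ih =>
    have hm := hact [] j I m next rfl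
    refine ih ⟨0, hm⟩ (fun h i I m' n' e => hact (0 :: h) i I m' n' ?_)
      (fun h m' w n' e => hch (0 :: h) m' w n' ?_) <;> simpa [sub, hm] using e
  | chance m w next ih =>
    have hm := hch [] m w next rfl
    refine ih ⟨0, hm⟩ (fun h i I m' n' e => hact (0 :: h) i I m' n' ?_)
      (fun h m' w n' e => hch (0 :: h) m' w n' ?_) <;> simpa [sub, hm] using e

end GameTree

/-! ### Nodes, available profiles and results of query trees -/

namespace QueryTree

theorem available_append {T' : QueryTree N D S} {b : ∀ i, D i} {v : List ℕ} {u : List ℕ} :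
    ∀ {T : QueryTree N D S}, T.sub u = some T' →
      (T.Available b (u ++ v) ↔ T.Available b u ∧ T'.Available b v) := by
  induction u with
  | nil => intro T h; cases T <;> (simp only [sub, Option.some.injEq] at h; subst h; simp [Available])
  | cons x u ih =>
    intro T h
    cases T with
    | leaf X p => simp [sub] at h
    | query i m part child =>
      by_cases hx : x < m
      · simp only [sub, hx, dif_pos] at h
        simp [Available, hx, ih h, and_assoc]
      · simp [sub, hx] at h

theorem sub_append {T' : QueryTree N D S} {v : List ℕ} {u : List ℕ} :
    ∀ {T : QueryTree N D S}, T.sub u = some T' → T.sub (u ++ v) = T'.sub v := by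
  induction u with
  | nil => intro T h; cases T <;> (simp only [sub, Option.some.injEq] at h; subst h; simp)
  | cons x u ih =>
    intro T h
    cases T with
    | leaf X p => simp [sub] at h
    | query i m part child =>
      by_cases hx : x < m
      · simp only [sub, hx, dif_pos] at h
        simp [sub, hx, ih h]
      · simp [sub, hx] at h

theorem queried_append {T T' : QueryTree N D S} {i : N} {u v : List ℕ} (h : T.sub u = some T') :
    T.Queried i (u ++ v) ↔ T'.Queried i v := by
  simp only [Queried, sub_append h]

theorem diverge_append {T T' : QueryTree N D S} {u v : List ℕ} {a b : ∀ i, D i}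
    (h : T.sub u = some T') (ha : T.Available a u) (hb : T.Available b u) :
    T.Diverge (u ++ v) a b ↔ T'.Diverge v a b := by
  simp only [Diverge, List.append_assoc, available_append h, ha, hb, true_and]

theorem Result.of_sub {T T' : QueryTree N D S} {u : List ℕ} {b : ∀ i, D i} {X : S} {p : N → ℝ}
    (h : T.sub u = some T') (hb : T.Available b u) (hr : T'.Result b X p) : T.Result b X p := by
  obtain ⟨v, h1, h2⟩ := hr
  exact ⟨u ++ v, by rw [sub_append h, h1], (available_append h).2 ⟨hb, h2⟩⟩

theorem IsRoundTableOn.part_eq {E : ∀ i, Set (D i)} {i : N} {m : ℕ} {part : Fin m → Set (D i)}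
    {child : Fin m → QueryTree N D S} (h : IsRoundTableOn E (query i m part child))
    {t : D i} {x y : Fin m} (hx : t ∈ part x) (hy : t ∈ part y) : x = y := by
  by_contra hne
  exact Set.disjoint_left.1 (h.2.2.1 x y hne) hx hy

/-- Subdomains at a query are disjoint, so a profile has only one path, and its leaf lies below
every node at which it is available. -/
theorem Result.sub {T' : QueryTree N D S} {b : ∀ i, D i} {X : S} {p : N → ℝ} {u : List ℕ} :
    ∀ {T : QueryTree N D S} {E : ∀ i, Set (D i)}, IsRoundTableOn E T → T.sub u = some T' →
      T.Available b u → T.Result b X p → T'.Result b X p := by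
  induction u with
  | nil =>
    intro T E _ h _ hr
    cases T <;> (simp only [QueryTree.sub, Option.some.injEq] at h; subst h; exact hr)
  | cons x u ih =>
    intro T E hT h hb hr
    cases T with
    | leaf X p => simp [QueryTree.sub] at h
    | query i m part child =>
      obtain ⟨hx, hbx, hb⟩ := hb
      obtain ⟨v, h1, h2⟩ := hr
      cases v with
      | nil => simp [QueryTree.sub] at h1
      | cons y v =>
        obtain ⟨hy, hby, hb'⟩ := h2
        obtain rfl : x = y := congrArg Fin.val (hT.part_eq hbx hby)
        simp only [QueryTree.sub, hx, dif_pos] at h h1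
        exact ih (hT.2.2.2.2 ⟨x, hx⟩) h hb ⟨v, h1, hb'⟩

theorem Result.unique {T : QueryTree N D S} {E : ∀ i, Set (D i)} (hT : IsRoundTableOn E T)
    {b : ∀ i, D i} {X X' : S} {p p' : N → ℝ} (h : T.Result b X p) (h' : T.Result b X' p') :
    X = X' := by
  obtain ⟨u, h1, h2⟩ := h
  obtain ⟨v, h3, -⟩ := h'.sub hT h1 h2
  cases v with
  | nil =>
    simp only [QueryTree.sub, Option.some.injEq] at h3
    cases h3
    rfl
  | cons x v => simp [QueryTree.sub] at h3

theorem IsRoundTableOn.exists_result {b : ∀ i, D i} {T : QueryTree N D S} :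
    ∀ {E : ∀ i, Set (D i)}, IsRoundTableOn E T → (∀ i, b i ∈ E i) → ∃ X p, T.Result b X p := by
  induction T with
  | leaf X p => intro E _ _; exact ⟨X, p, [], rfl, trivial⟩
  | query i m part child ih =>
    intro E hT hb
    have := hb i
    rw [← hT.2.2.2.1] at this
    obtain ⟨x, hx⟩ := Set.mem_iUnion.1 this
    obtain ⟨X, p, hr⟩ := ih x (hT.2.2.2.2 x) (by
      intro j
      by_cases hj : j = i
      · subst hj; simpa using hx
      · simpa [hj] using hb j)
    exact ⟨X, p, hr.of_sub (u := [(x : ℕ)]) (by simp [QueryTree.sub])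
      (by simp [Available, hx])⟩

theorem IsRoundTableOn.nonempty_outcome {T : QueryTree N D S} :
    ∀ {E : ∀ i, Set (D i)}, IsRoundTableOn E T → Nonempty S := by
  induction T with
  | leaf X p => intro E _; exact ⟨X⟩
  | query i m part child ih =>
    intro E hT
    exact ih ⟨0, by have := hT.1; omega⟩ (hT.2.2.2.2 _)

/-! ### The neighborhood of a node as a budget of queries -/

/-- The number of nodes before `v`, starting from the root, at which agent `i` is queried. -/
noncomputable def queriesBefore (i : N) : QueryTree N D S → List ℕ → ℕ
  | leaf _ _, _ => 0
  | query _ _ _ _, [] => 0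
  | query j m _ child, x :: v =>
      (if j = i then 1 else 0) + if hx : x < m then queriesBefore i (child ⟨x, hx⟩) v else 0

theorem queriesBefore_nil (i : N) (T : QueryTree N D S) : T.queriesBefore i [] = 0 := by
  cases T <;> rfl

theorem queriesBefore_cons (i j : N) (m : ℕ) (part : Fin m → Set (D j))
    (child : Fin m → QueryTree N D S) (x : Fin m) (v : List ℕ) :
    (query j m part child).queriesBefore i (x :: v) =
      (if j = i then 1 else 0) + (child x).queriesBefore i v := by
  simp [queriesBefore]

theorem queriesBefore_mono (i : N) {v : List ℕ} : ∀ (T : QueryTree N D S) {w : List ℕ},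
    v <+: w → T.queriesBefore i v ≤ T.queriesBefore i w := by
  induction v with
  | nil => intro T w _; simp [queriesBefore_nil]
  | cons x v ih =>
    intro T w h
    cases w with
    | nil => simp at h
    | cons y w =>
      obtain ⟨rfl, h'⟩ := List.cons_prefix_cons.1 h
      cases T with
      | leaf X p => simp [queriesBefore]
      | query j m part child =>
        by_cases hx : x < m
        · simpa [queriesBefore, hx] using ih _ h'
        · simp [queriesBefore, hx]

theorem finite_prefixes (v : List ℕ) : {w | w <+: v}.Finite :=
  (v.inits.toFinset.finite_toSet).subset (by intro w hw; simpa using hw)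

theorem ncard_queried_prefixes (i : N) {v : List ℕ} : ∀ (T : QueryTree N D S),
    Set.ncard {w | w <+: v ∧ T.Queried i w} =
      T.queriesBefore i v + if T.Queried i v then 1 else 0 := by
  induction v with
  | nil =>
    intro T
    by_cases h : T.Queried i []
    · have : {w | w <+: [] ∧ T.Queried i w} = {[]} := by ext w; aesop
      rw [this]; simp [h, queriesBefore_nil]
    · have : {w | w <+: [] ∧ T.Queried i w} = ∅ := by ext w; aesop
      rw [this]; simp [h, queriesBefore_nil]
  | cons x v ih =>
    intro T
    cases T with
    | leaf X p =>
      have h : ∀ w, ¬ (leaf X p : QueryTree N D S).Queried i w := by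
        rintro w ⟨m, part, child, h⟩
        cases w <;> simp [sub] at h
      simp [h, queriesBefore]
    | query j m part child =>
      have hroot : (query j m part child).Queried i [] ↔ j = i := by
        constructor
        · rintro ⟨m', part', child', h⟩
          simp only [sub, Option.some.injEq] at h
          cases h; rfl
        · rintro rfl
          exact ⟨m, part, child, rfl⟩
      by_cases hx : x < m
      · have hq : ∀ w, (query j m part child).Queried i (x :: w) ↔
            (child ⟨x, hx⟩).Queried i w := by
          intro w; simp [Queried, sub, hx]
        have hset : {w | w <+: x :: v ∧ (query j m part child).Queried i w} =
            (if j = i then {[]} else ∅) ∪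
              (List.cons x) '' {w | w <+: v ∧ (child ⟨x, hx⟩).Queried i w} := by
          ext w
          cases w with
          | nil => by_cases hj : j = i <;> simp [hroot, hj]
          | cons y w =>
            have h0 : (y :: w) ∉ (if j = i then {[]} else ∅ : Set (List ℕ)) := by
              by_cases hj : j = i <;> simp [hj]
            simp only [Set.mem_ofPred_eq, List.cons_prefix_cons, Set.mem_union, h0, false_or,
              Set.mem_image, List.cons.injEq]
            constructor
            · rintro ⟨⟨rfl, h1⟩, h2⟩
              exact ⟨w, ⟨h1, (hq w).1 h2⟩, rfl, rfl⟩
            · rintro ⟨w', ⟨h1, h2⟩, rfl, rfl⟩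
              exact ⟨⟨rfl, h1⟩, (hq _).2 h2⟩
        have hfin : {w | w <+: v ∧ (child ⟨x, hx⟩).Queried i w}.Finite :=
          (finite_prefixes v).subset fun w h => h.1
        rw [hset, Set.ncard_union_eq _ (by split_ifs <;> simp) (hfin.image _),
          Set.ncard_image_of_injective _ List.cons_injective, ih]
        · simp only [queriesBefore, hx, dif_pos, hq]
          by_cases hj : j = i <;> simp [hj, add_assoc]
        · by_cases hj : j = i <;> simp [hj]
      · have hq : ∀ w, ¬ (query j m part child).Queried i (x :: w) := by
          intro w; simp [Queried, sub, hx]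
        have hset : {w | w <+: x :: v ∧ (query j m part child).Queried i w} =
            (if j = i then {[]} else ∅) := by
          ext w
          cases w with
          | nil => by_cases hj : j = i <;> simp [hroot, hj]
          | cons y w =>
            have h0 : (y :: w) ∉ (if j = i then {[]} else ∅ : Set (List ℕ)) := by
              by_cases hj : j = i <;> simp [hj]
            simp only [Set.mem_ofPred_eq, List.cons_prefix_cons, h0, iff_false]
            rintro ⟨⟨rfl, -⟩, h⟩
            exact hq _ h
        rw [hset]
        by_cases hj : j = i <;> simp [hj, queriesBefore, hx, hq]

/-- `numQueries` omits the start `u` and counts the end; `queriesBefore` does the opposite. The two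
corrections are the `+ 1` for `u` and the `if` for the end. -/
theorem numQueries_add_one {T T' : QueryTree N D S} {i : N} {u : List ℕ} (v : List ℕ)
    (h : T.sub u = some T') (hq : T'.Queried i []) :
    T.numQueries i u (u ++ v) + 1 = T'.queriesBefore i v + if T'.Queried i v then 1 else 0 := by
  rw [← ncard_queried_prefixes]
  have h1 : {w | u <+: w ∧ u ≠ w ∧ w <+: u ++ v ∧ T.Queried i w} =
      (fun w => u ++ w) '' ({w | w <+: v ∧ T'.Queried i w} \ {[]}) := by
    ext w
    simp only [Set.mem_ofPred_eq, Set.mem_image, Set.mem_sdiff, Set.mem_singleton_iff]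
    constructor
    · rintro ⟨⟨w, rfl⟩, h2, h3, h4⟩
      exact ⟨w, ⟨⟨(List.prefix_append_right_inj u).1 h3, (queried_append h).1 h4⟩,
        by rintro rfl; simp at h2⟩, rfl⟩
    · rintro ⟨w, ⟨⟨h2, h3⟩, h4⟩, rfl⟩
      exact ⟨List.prefix_append _ _, by simpa using h4,
        (List.prefix_append_right_inj u).2 h2, (queried_append h).2 h3⟩
  rw [numQueries, h1, Set.ncard_image_of_injective _ (List.append_right_injective u)]
  exact Set.ncard_sdiff_singleton_add_one ⟨List.nil_prefix, hq⟩
    ((finite_prefixes v).subset fun w h => h.1)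

theorem InNeighborhood.queriesBefore_lt {T T' : QueryTree N D S} {i : N} {k : ℕ∞}
    {u v : List ℕ} (h : T.sub u = some T') (hq : T'.Queried i [])
    (hv : T.InNeighborhood i k u v) : ∃ w, v = u ++ w ∧ (T'.queriesBefore i w : ℕ∞) < k + 1 := by
  obtain ⟨v', ⟨⟨w', rfl⟩, hl⟩, ⟨w, rfl⟩, hvv⟩ := hv
  refine ⟨w, rfl, ?_⟩
  have hw : w <+: w' := (List.prefix_append_right_inj u).1 hvv
  refine lt_of_le_of_lt (Nat.cast_le.2 (queriesBefore_mono i T' hw)) ?_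
  have hn := numQueries_add_one w' h hq
  rcases hl with ⟨hq', hk⟩ | ⟨⟨X, p, hX⟩, hk⟩
  · rw [queried_append h] at hq'
    simp only [hq', if_true, Nat.add_right_cancel_iff] at hn
    rw [← hn, hk, ENat.lt_add_one_iff (by rw [← hk]; simp)]
  · have hnq : ¬ T'.Queried i w' := by
      rintro ⟨m, part, child, h'⟩
      rw [sub_append h, h'] at hX
      simp at hX
    simp only [hnq, if_false, add_zero] at hn
    rw [← hn, Nat.cast_add, Nat.cast_one]
    exact (ENat.add_lt_add_iff_right (by simp)).2 hk

/-- Finds the marked node: walking from `v` towards the leaf `l`, either the `k`-th query of `i` is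
met, counted from the root, or the leaf comes first. -/
theorem exists_limit {i : N} {X : S} {p : N → ℝ} {l : List ℕ} :
    ∀ {T : QueryTree N D S} {v : List ℕ} {k : ℕ∞}, T.sub l = some (leaf X p) → v <+: l →
      (T.queriesBefore i v : ℕ∞) < k → ∃ w, v <+: w ∧ w <+: l ∧
        ((T.Queried i w ∧ (T.queriesBefore i w : ℕ∞) + 1 = k) ∨
          (w = l ∧ (T.queriesBefore i w : ℕ∞) < k)) := by
  induction l with
  | nil =>
    intro T v k _ hv hk
    obtain rfl : v = [] := by simpa using hv
    exact ⟨[], List.prefix_rfl, List.prefix_rfl, Or.inr ⟨rfl, hk⟩⟩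
  | cons x l ih =>
    intro T v k hl hv hk
    cases T with
    | leaf X p => simp [sub] at hl
    | query j m part child =>
      by_cases hx : x < m
      swap
      · simp [sub, hx] at hl
      simp only [sub, hx, dif_pos] at hl
      have hq : ∀ w, (query j m part child).Queried i (x :: w) ↔
          (child ⟨x, hx⟩).Queried i w := by
        intro w; simp [Queried, sub, hx]
      have hc : ∀ w, (query j m part child).queriesBefore i (x :: w) =
          (if j = i then 1 else 0) + (child ⟨x, hx⟩).queriesBefore i w := by
        intro w; simp [queriesBefore, hx]
      by_cases hj : j = i
      · subst hj
        obtain ⟨k, rfl⟩ : ∃ k', k = k' + 1 :=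
          ⟨k - 1, (tsub_add_cancel_of_le (Order.one_le_iff_pos.2 (pos_of_gt hk))).symm⟩
        -- Here the root is itself the marked node. Otherwise the search goes on in the child with
        -- the budget reduced by the query at the root.
        by_cases hvk : v = [] ∧ k = 0
        · obtain ⟨rfl, rfl⟩ := hvk
          exact ⟨[], List.prefix_rfl, List.nil_prefix,
            Or.inl ⟨⟨m, part, child, rfl⟩, by simp [queriesBefore]⟩⟩
        obtain ⟨v', hv', hvp, hk'⟩ : ∃ v', v <+: x :: v' ∧ v' <+: l ∧
            ((child ⟨x, hx⟩).queriesBefore j v' : ℕ∞) < k := by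
          cases v with
          | nil =>
            refine ⟨[], List.nil_prefix, List.nil_prefix, ?_⟩
            simp only [queriesBefore_nil, Nat.cast_zero]
            exact pos_iff_ne_zero.2 fun h => hvk ⟨rfl, h⟩
          | cons y v =>
            obtain ⟨rfl, hv'⟩ := List.cons_prefix_cons.1 hv
            refine ⟨v, List.prefix_rfl, hv', ?_⟩
            rw [hc] at hk
            simp only [if_true, Nat.cast_add, Nat.cast_one, add_comm (1 : ℕ∞)] at hk
            exact (ENat.add_lt_add_iff_right (by simp)).1 hk
        obtain ⟨w, h1, h2, h3⟩ := ih hl hvp hk'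
        refine ⟨x :: w, hv'.trans (List.cons_prefix_cons.2 ⟨rfl, h1⟩),
          List.cons_prefix_cons.2 ⟨rfl, h2⟩, ?_⟩
        rw [hq, hc]
        simp only [if_true, Nat.cast_add, Nat.cast_one, add_comm (1 : ℕ∞)]
        rcases h3 with ⟨h3, h4⟩ | ⟨h3, h4⟩
        · exact Or.inl ⟨h3, by rw [h4]⟩
        · exact Or.inr ⟨by rw [h3], (ENat.add_lt_add_iff_right (by simp)).2 h4⟩
      · simp only [hj, if_false, zero_add] at hc
        obtain ⟨v', hv', hvp, hk'⟩ : ∃ v', v <+: x :: v' ∧ v' <+: l ∧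
            ((child ⟨x, hx⟩).queriesBefore i v' : ℕ∞) < k := by
          cases v with
          | nil =>
            refine ⟨[], List.nil_prefix, List.nil_prefix, ?_⟩
            simpa [queriesBefore_nil] using hk
          | cons y v =>
            obtain ⟨rfl, hv'⟩ := List.cons_prefix_cons.1 hv
            exact ⟨v, List.prefix_rfl, hv', by rwa [hc] at hk⟩
        obtain ⟨w, h1, h2, h3⟩ := ih hl hvp hk'
        refine ⟨x :: w, hv'.trans (List.cons_prefix_cons.2 ⟨rfl, h1⟩),
          List.cons_prefix_cons.2 ⟨rfl, h2⟩, ?_⟩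
        rw [hq, hc]
        rcases h3 with h3 | ⟨h3, h4⟩
        · exact Or.inl h3
        · exact Or.inr ⟨by rw [h3], h4⟩

theorem inNeighborhood_of_queriesBefore_lt {T T' : QueryTree N D S} {i : N} {k : ℕ∞}
    {u v l : List ℕ} {X : S} {p : N → ℝ} (h : T.sub u = some T') (hq : T'.Queried i [])
    (hl : T'.sub l = some (leaf X p)) (hv : v <+: l)
    (hk : (T'.queriesBefore i v : ℕ∞) < k + 1) : T.InNeighborhood i k u (u ++ v) := by
  obtain ⟨w, h1, h2, h3⟩ := exists_limit hl hv hk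
  refine ⟨u ++ w, ⟨List.prefix_append _ _, ?_⟩, List.prefix_append _ _,
    (List.prefix_append_right_inj u).2 h1⟩
  have hn := numQueries_add_one w h hq
  rcases h3 with ⟨h3, h4⟩ | ⟨rfl, h4⟩
  · refine Or.inl ⟨(queried_append h).2 h3, ?_⟩
    simp only [h3, if_true, Nat.add_right_cancel_iff] at hn
    rw [hn]
    exact (ENat.add_left_injective_of_ne_top (by simp : (1 : ℕ∞) ≠ ⊤)) h4
  · refine Or.inr ⟨⟨X, p, by rw [sub_append h, hl]⟩, ?_⟩
    have hnq : ¬ T'.Queried i w := by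
      rintro ⟨m, part, child, h'⟩
      rw [hl] at h'
      simp at h'
    simp only [hnq, if_false, add_zero] at hn
    rw [← hn, Nat.cast_add, Nat.cast_one] at h4
    exact (ENat.add_lt_add_iff_right (by simp)).1 h4

/-! ### From round-table trees to games -/

/-- The game of perfect information in which the queried agent announces the index of a subdomain;
`u` is the position of the tree in the whole game, which labels the information set. -/
def toGame : List ℕ → QueryTree N D S → GameTree N S
  | _, leaf X p => .terminal X p
  | u, query i m _ child => .decision i (Encodable.encode u) m fun x => (child x).toGame (u ++ [↑x])

/-- Truthful answers of type `t` of agent `i` in the game of the tree `T`. -/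
noncomputable def truthful (T : QueryTree N D S) (i : N) (t : D i) (I : ℕ) : ℕ :=
  if h : ∃ x m part child, ∃ hx : x < m,
      T.sub (((Encodable.decode I : Option (List ℕ))).getD []) = some (query i m part child) ∧
        t ∈ part ⟨x, hx⟩ then h.choose else 0

theorem toGame_sub {v : List ℕ} : ∀ (u : List ℕ) (T : QueryTree N D S),
    (T.toGame u).sub v = (T.sub v).map (toGame (u ++ v)) := by
  induction v with
  | nil => intro u T; cases T <;> simp [toGame, GameTree.sub, sub]
  | cons x v ih =>
    intro u T
    cases T with
    | leaf X p => simp [toGame, GameTree.sub, sub]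
    | query i m part child =>
      by_cases hx : x < m
      · simp [toGame, GameTree.sub, sub, hx, ih]
      · simp [toGame, GameTree.sub, sub, hx]

theorem toGame_sub_decision {T : QueryTree N D S} {u v : List ℕ} {i : N} {I m : ℕ}
    {next : Fin m → GameTree N S} (h : (T.toGame u).sub v = some (.decision i I m next)) :
    I = Encodable.encode (u ++ v) ∧ ∃ part child, T.sub v = some (query i m part child) := by
  rw [toGame_sub] at h
  obtain ⟨T', h1, h2⟩ := Option.map_eq_some_iff.1 h
  cases T' with
  | leaf X p => simp [toGame] at h2
  | query j m' part child =>
    simp only [toGame] at h2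
    cases h2
    exact ⟨rfl, part, child, h1⟩

theorem toGame_sub_ne_chance {T : QueryTree N D S} {u v : List ℕ} {m : ℕ} {w : Fin m → ℝ}
    {next : Fin m → GameTree N S} : (T.toGame u).sub v ≠ some (.chance m w next) := by
  intro h
  rw [toGame_sub] at h
  obtain ⟨T', h1, h2⟩ := Option.map_eq_some_iff.1 h
  cases T' <;> simp [toGame] at h2

/-- The current domains at a node of a round-table tree. -/
theorem IsRoundTableOn.exists_domains {T' : QueryTree N D S} {u : List ℕ} :
    ∀ {T : QueryTree N D S} {E : ∀ i, Set (D i)}, IsRoundTableOn E T → (∀ j, (E j).Nonempty) →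
      T.sub u = some T' → ∃ E', IsRoundTableOn E' T' ∧ (∀ j, (E' j).Nonempty) ∧
        (∀ j, E' j ⊆ E j) ∧ (∀ b : ∀ i, D i, (∀ j, b j ∈ E' j) → T.Available b u) ∧
        ∀ (i : N) (t : D i) (p : List ℕ) (σ : ℕ → ℕ), t ∈ E i →
          (∀ v m part child, T.sub v = some (query i m part child) → ∀ x, t ∈ part x →
            σ (Encodable.encode (p ++ v)) = x) → (T.toGame p).Follows i σ u → t ∈ E' i := by
  induction u with
  | nil =>
    intro T E hT hE h
    refine ⟨E, ?_, hE, fun _ => subset_rfl, fun _ _ => ?_, fun _ _ _ _ h _ _ => h⟩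
    · cases T <;> (simp only [sub, Option.some.injEq] at h; subst h; exact hT)
    · cases T <;> trivial
  | cons x u ih =>
    intro T E hT hE h
    cases T with
    | leaf X p => simp [sub] at h
    | query j m part child =>
      by_cases hx : x < m
      swap
      · simp [sub, hx] at h
      simp only [sub, hx, dif_pos] at h
      have hE' : ∀ l, (Function.update E j (part ⟨x, hx⟩) l).Nonempty := by
        intro l
        by_cases hl : l = j
        · subst hl; simpa using hT.2.1 ⟨x, hx⟩
        · simpa [hl] using hE l
      obtain ⟨E', h1, h2, h0, h3, h4⟩ := ih (hT.2.2.2.2 ⟨x, hx⟩) hE' h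
      have hsubs : ∀ t ∈ part ⟨x, hx⟩, t ∈ E j := by
        intro t ht
        rw [← hT.2.2.2.1]
        exact Set.mem_iUnion.2 ⟨_, ht⟩
      refine ⟨E', h1, h2, ?_, ?_, ?_⟩
      · intro l t ht
        have h5 := h0 l ht
        by_cases hl : l = j
        · subst hl
          rw [Function.update_self] at h5
          exact hsubs t h5
        · simpa [hl] using h5
      · intro b hb
        refine ⟨hx, ?_, h3 b hb⟩
        simpa using h0 j (hb j)
      · intro i t p σ ht hσ hf
        have hs : ∀ g, ((query j m part child).toGame p).sub (x :: g) =
            ((child ⟨x, hx⟩).toGame (p ++ [x])).sub g := by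
          intro g; simp [toGame, GameTree.sub, hx]
        refine h4 i t (p ++ [x]) σ ?_ ?_ (hf.tail hs)
        · by_cases hi : i = j
          · subst hi
            rw [Function.update_self]
            rw [← hT.2.2.2.1] at ht
            obtain ⟨y, hy⟩ := Set.mem_iUnion.1 ht
            have h5 := hσ [] m part child rfl y hy
            have h6 : x = _ := hf [] x (Encodable.encode p) (by simp) ⟨m, _, rfl⟩
            rw [List.append_nil] at h5
            obtain rfl : y = ⟨x, hx⟩ := Fin.ext (h5.symm.trans h6.symm)
            exact hy
          · simpa [hi] using ht
        · intro v m' part' child' hv y hy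
          rw [List.append_assoc]
          exact hσ (x :: v) m' part' child' (by simpa [sub, hx] using hv) y hy

/-- Disjointness of the subdomains makes the choice in `truthful` the only possible one. The default
`0` concerns types already excluded from the current domain. -/
theorem truthful_eq {T : QueryTree N D S} (hT : T.IsRoundTable) (hD : ∀ i, Nonempty (D i))
    {i : N} {t : D i} {u : List ℕ} {m : ℕ} {part : Fin m → Set (D i)}
    {child : Fin m → QueryTree N D S} (h : T.sub u = some (query i m part child)) {x : Fin m}
    (hx : t ∈ part x) : T.truthful i t (Encodable.encode u) = x := by
  have hex : ∃ x m part child, ∃ hx : x < m,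
      T.sub (((Encodable.decode (Encodable.encode u) : Option (List ℕ))).getD []) =
        some (query i m part child) ∧ t ∈ part ⟨x, hx⟩ :=
    ⟨x, m, part, child, x.2, by simpa using h, hx⟩
  rw [truthful, dif_pos hex]
  obtain ⟨m', part', child', hx', h1, h2⟩ := hex.choose_spec
  rw [Encodable.encodek, Option.getD_some, h] at h1
  cases h1
  obtain ⟨E, hE, -⟩ := hT.exists_domains (fun j => Set.univ_nonempty) h
  exact congrArg Fin.val (hE.part_eq h2 hx)

theorem truthful_lt {T : QueryTree N D S} (hT : T.IsRoundTable) (hD : ∀ i, Nonempty (D i))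
    {i : N} {t : D i} {u : List ℕ} {m : ℕ} {part : Fin m → Set (D i)}
    {child : Fin m → QueryTree N D S} (h : T.sub u = some (query i m part child)) :
    T.truthful i t (Encodable.encode u) < m := by
  by_cases hex : ∃ x m part child, ∃ hx : x < m,
      T.sub (((Encodable.decode (Encodable.encode u) : Option (List ℕ))).getD []) =
        some (query i m part child) ∧ t ∈ part ⟨x, hx⟩
  · rw [truthful, dif_pos hex]
    obtain ⟨m', part', child', hx', h1, h2⟩ := hex.choose_spec
    rw [Encodable.encodek, Option.getD_some, h] at h1
    cases h1
    exact hx'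
  · rw [truthful, dif_neg hex]
    obtain ⟨E, hE, -⟩ := hT.exists_domains (fun j => Set.univ_nonempty) h
    have := hE.1
    omega

/-- The mechanism given by a round-table tree and truthful answers. -/
noncomputable def toMechanism (T : QueryTree N D S) (hT : T.IsRoundTable)
    (hD : ∀ i, Nonempty (D i)) : Mechanism N D S where
  game := T.toGame []
  isGame :=
    { action_exists := by
        intro h i I m next hs
        obtain ⟨rfl, part, child, h'⟩ := toGame_sub_decision hs
        have := truthful_lt (t := (hD i).some) hT hD h'
        omega
      prob_pos := fun h m w next hs => absurd hs toGame_sub_ne_chance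
      prob_sum := fun h m w next hs => absurd hs toGame_sub_ne_chance
      same_actions := by
        intro h h' i I m m' next next' hs hs'
        obtain ⟨rfl, -⟩ := toGame_sub_decision hs
        obtain ⟨he, -⟩ := toGame_sub_decision hs'
        -- Information sets are codes of nodes, hence singletons.
        obtain rfl : h = h' := by simpa using he
        rw [hs] at hs'
        cases hs'
        rfl
      perfect_recall := by
        rintro i I h h' ⟨m, next, hs⟩ ⟨m', next', hs'⟩
        obtain ⟨rfl, -⟩ := toGame_sub_decision hs
        obtain ⟨he, -⟩ := toGame_sub_decision hs'
        obtain rfl : h = h' := by simpa using he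
        rfl }
  strategy := T.truthful
  isStrategy := by
    intro i t h I m next hs
    obtain ⟨rfl, part, child, h'⟩ := toGame_sub_decision hs
    exact truthful_lt hT hD h'

theorem IsRoundTableOn.result_of_mem_plays {b : ∀ i, D i} {σ : N → ℕ → ℕ}
    {o : S × (N → ℝ)} {T : QueryTree N D S} :
    ∀ {E : ∀ i, Set (D i)} {u : List ℕ}, IsRoundTableOn E T → (∀ i, b i ∈ E i) →
      (∀ i v m part child, T.sub v = some (query i m part child) → ∀ x, b i ∈ part x →
        σ i (Encodable.encode (u ++ v)) = x) →
      o ∈ GameTree.plays σ (T.toGame u) → T.Result b o.1 o.2 := by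
  induction T with
  | leaf X p =>
    intro E u _ _ _ ho
    obtain rfl : o = (X, p) := by simpa [toGame, GameTree.plays] using ho
    exact ⟨[], rfl, trivial⟩
  | query j m part child ih =>
    rintro E u hT hb hσ ⟨a, ha, ho⟩
    have hj := hb j
    rw [← hT.2.2.2.1] at hj
    obtain ⟨y, hy⟩ := Set.mem_iUnion.1 hj
    have h1 := hσ j [] m part child rfl y hy
    rw [List.append_nil, ← ha] at h1
    obtain rfl : a = y := Fin.ext h1
    refine (ih a (hT.2.2.2.2 a) ?_ ?_ ho).of_sub (u := [(a : ℕ)]) (by simp [QueryTree.sub])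
      (by simp [Available, hy])
    · intro l
      by_cases hl : l = j
      · subst hl; simpa using hy
      · simpa [hl] using hb l
    · intro i v m' part' child' hv x hx
      rw [List.append_assoc]
      exact hσ i (a :: v) m' part' child' (by simpa [QueryTree.sub] using hv) x hx

/-- Every outcome that may be reached when agent `i` answers as type `t` in her first `k` moves is
the result of a profile that differs from one with type `t` of `i` at later moves only. -/
theorem IsRoundTableOn.exists_profile {i : N} {t : D i} {σ : ℕ → ℕ} {o : S × (N → ℝ)}
    {T : QueryTree N D S} :
    ∀ {E : ∀ i, Set (D i)} {u : List ℕ} {k : ℕ∞}, IsRoundTableOn E T → (∀ i, (E i).Nonempty) →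
      (∀ v m part child, T.sub v = some (query i m part child) → ∀ x, t ∈ part x →
        σ (Encodable.encode (u ++ v)) = x) →
      o ∈ GameTree.outcomes i σ k (T.toGame u) →
      ∃ b : ∀ i, D i, (∀ j, b j ∈ E j) ∧ T.Result b o.1 o.2 ∧
        ∀ v, (T.queriesBefore i v : ℕ∞) < k → ¬ T.Diverge v (Function.update b i t) b := by
  induction T with
  | leaf X p =>
    intro E u k _ hE _ ho
    obtain rfl : o = (X, p) := by simpa [toGame, GameTree.outcomes] using ho
    choose b hb using hE
    refine ⟨b, hb, ⟨[], rfl, trivial⟩, ?_⟩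
    rintro v - ⟨x, y, -, h, -⟩
    cases v <;> simp [Available] at h
  | query j m part child ih =>
    rintro E u k hT hE hσ ⟨a, ha, ho⟩
    have hE' : ∀ l, (Function.update E j (part a) l).Nonempty := by
      intro l
      by_cases hl : l = j
      · subst hl; simpa using hT.2.1 a
      · simpa [hl] using hE l
    obtain ⟨b, hb, hr, hd⟩ := ih a (hT.2.2.2.2 a) hE' (by
      intro v m' part' child' hv x hx
      rw [List.append_assoc]
      exact hσ (a :: v) m' part' child' (by simpa [QueryTree.sub] using hv) x hx) ho
    have hba : b j ∈ part a := by simpa using hb j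
    refine ⟨b, ?_, hr.of_sub (u := [(a : ℕ)]) (by simp [QueryTree.sub])
      (by simp [Available, hba]), ?_⟩
    · intro l
      by_cases hl : l = j
      · subst hl
        rw [← hT.2.2.2.1]
        exact Set.mem_iUnion.2 ⟨a, hba⟩
      · simpa [hl] using hb l
    · intro v hv hdiv
      cases v with
      | nil =>
        -- No divergence at the root: an agent other than `i` has the same type in both profiles,
        -- and the answer of `i` is bound to that of `t` because the budget is positive.
        obtain ⟨x, y, hxy, ⟨hx, h1, -⟩, ⟨hy, h2, -⟩⟩ := hdiv
        obtain rfl : y = a := congrArg Fin.val (hT.part_eq h2 hba)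
        apply hxy
        by_cases hj : j = i
        · subst hj
          have hk : k ≠ 0 := by rintro rfl; simp at hv
          rw [Function.update_self] at h1
          have h3 := hσ [] m part child rfl ⟨x, hx⟩ h1
          rw [List.append_nil] at h3
          rw [ha rfl hk, h3]
        · rw [Function.update_of_ne hj] at h1
          exact congrArg Fin.val (hT.part_eq h1 h2)
      | cons z v =>
        obtain ⟨x, y, hxy, ⟨hz, h1, h1'⟩, ⟨hz', h2, h2'⟩⟩ := hdiv
        obtain rfl : z = a := congrArg Fin.val (hT.part_eq h2 hba)
        refine hd v ?_ ⟨x, y, hxy, h1', h2'⟩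
        rw [queriesBefore_cons] at hv
        by_cases hj : j = i
        · subst hj
          simp only [if_true, Nat.cast_add, Nat.cast_one] at hv ⊢
          exact lt_tsub_iff_left.2 hv
        · simpa [hj] using hv

theorem KStepOSP.toMechanism {T : QueryTree N D S} {cost : ∀ i, D i → S → ℝ} {k : ℕ∞}
    (h : T.KStepOSP cost k) (hT : T.IsRoundTable) (hD : ∀ i, Nonempty (D i)) :
    (T.toMechanism hT hD).KStepOSP cost k := by
  rintro i t σ' hσ' I ⟨⟨g, ⟨m, next, hg⟩, hf⟩, -, -, hne⟩ o ho o' ho'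
  obtain ⟨rfl, part, child, hu⟩ := toGame_sub_decision hg
  rw [List.nil_append] at *
  rw [GameTree.mem_outcomesFrom_iff] at ho
  obtain ⟨g1, m1, next1, hg1, ho⟩ := ho
  obtain ⟨g2, m2, next2, y, hg2, hy, ho'⟩ := ho'
  obtain rfl : g = g1 := by simpa using (toGame_sub_decision hg1).1
  obtain rfl : g = g2 := by simpa using (toGame_sub_decision hg2).1
  obtain ⟨E, hE, hEne, -, hav, hty⟩ :=
    IsRoundTableOn.exists_domains hT (fun j => Set.univ_nonempty) hu
  have htr : ∀ v m part child, T.sub v = some (query i m part child) → ∀ x, t ∈ part x →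
      T.truthful i t (Encodable.encode ([] ++ v)) = x :=
    fun v m part child hv x hx => truthful_eq hT hD hv hx
  -- The departure lies on the truthful path of `t`, so `t` has not been excluded from the current
  -- domain.
  have ht : t ∈ E i := hty i t [] (T.truthful i t) trivial htr hf
  have hgame : some ((query i m part child).toGame g) =
      (T.toGame []).sub g := by rw [toGame_sub, hu]; rfl
  have hgame1 := hgame.trans hg1
  have hgame2 := hgame.trans hg2
  rw [Option.some.injEq] at hgame1 hgame2
  rw [← hgame1] at ho
  simp only [toGame] at hgame2
  cases hgame2
  have hloc : ∀ v m' part' child',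
      (query i m part child).sub v = some (query i m' part' child') → ∀ x, t ∈ part' x →
      T.truthful i t (Encodable.encode (g ++ v)) = x :=
    fun v m' part' child' hv x hx => truthful_eq hT hD (by rw [sub_append hu, hv]) hx
  obtain ⟨b, hb, hbr, hbd⟩ := hE.exists_profile hEne hloc ho
  have hEy : ∀ l, (Function.update E i (part y) l).Nonempty := by
    intro l
    by_cases hl : l = i
    · subst hl; simpa using hE.2.1 y
    · simpa [hl] using hEne l
  -- After the deviating answer `y`, only some profile with this result is needed, so budget zero
  -- suffices.
  obtain ⟨c, hc, hcr, -⟩ := (hE.2.2.2.2 y).exists_profile (t := t) (u := g ++ [(y : ℕ)]) hEy (by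
    intro v m' part' child' hv x hx
    rw [List.append_assoc]
    exact hloc (y :: v) m' part' child' (by simpa [sub] using hv) x hx)
    (GameTree.outcomes_subset_zero i (T.truthful i t) σ' _ _ o' ho')
  have hcy : c i ∈ part y := by simpa using hc i
  have hcE : ∀ j, c j ∈ E j := by
    intro l
    by_cases hl : l = i
    · subst hl
      rw [← hE.2.2.2.1]
      exact Set.mem_iUnion.2 ⟨y, hcy⟩
    · simpa [hl] using hc l
  have haE : ∀ j, Function.update b i t j ∈ E j := by
    intro l
    by_cases hl : l = i
    · subst hl; simpa using ht
    · simpa [hl] using hb l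
  rw [← hE.2.2.2.1] at ht
  obtain ⟨x, hx⟩ := Set.mem_iUnion.1 ht
  have hxy : (x : ℕ) ≠ y := by
    rw [hy, ← truthful_eq hT hD hu hx]
    exact hne
  have hnd : ∀ v, T.InNeighborhood i k g v → ¬ T.Diverge v (Function.update b i t) b := by
    intro v hv
    obtain ⟨w, rfl, hw⟩ := hv.queriesBefore_lt hu ⟨m, part, child, rfl⟩
    rw [diverge_append hu (hav _ haE) (hav _ hb)]
    exact hbd w hw
  have hnd0 : ¬ T.Diverge g (Function.update b i t) b := by
    have := diverge_append (v := []) hu (hav _ haE) (hav _ hb)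
    rw [List.append_nil] at this
    rw [this]
    exact hbd [] (by simp [queriesBefore_nil])
  -- The true profile is `b` with the type of `i` replaced by `t`.
  have := h i g ⟨m, part, child, hu⟩ (Function.update b i t) b c (hav _ haE)
    ⟨hav _ hb, hnd0, hnd⟩
    ⟨x, y, hxy, (available_append hu).2 ⟨hav _ haE, by simpa [Available] using hx⟩,
      (available_append hu).2 ⟨hav _ hcE, by simpa [Available] using hcy⟩⟩
    o.1 o.2 o'.1 o'.2 (hbr.of_sub hu (hav _ hb))
    ((hcr.of_sub (u := [(y : ℕ)]) (T := query i m part child) (by simp [sub])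
      (by simp [Available, hcy])).of_sub hu (hav _ hcE))
  simpa using this

theorem Implements.toMechanism {T : QueryTree N D S} {f : (∀ i, D i) → S}
    (h : T.Implements f) (hT : T.IsRoundTable) (hD : ∀ i, Nonempty (D i)) :
    (T.toMechanism hT hD).Implements f := by
  intro b o ho
  obtain ⟨p, hp⟩ := h b
  refine Result.unique hT (IsRoundTableOn.result_of_mem_plays hT (fun _ => trivial) ?_ ho) hp
  intro i v m part child hv x hx
  exact truthful_eq hT hD hv hx

end QueryTree

/-! ### From games to round-table trees -/

/-- `Simulates s E G T`: the tree `T` results from the game `G` by fixing the random moves and by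
asking each agent, whose types are those in `E`, for the action that her strategy in `s` prescribes
whenever this action depends on her type. -/
inductive Simulates (s : ∀ i, D i → ℕ → ℕ) :
    (∀ i, Set (D i)) → GameTree N S → QueryTree N D S → Prop where
  | terminal (E : ∀ i, Set (D i)) (X : S) (p : N → ℝ) : Simulates s E (.terminal X p) (.leaf X p)
  | chance (E : ∀ i, Set (D i)) (m : ℕ) (w : Fin m → ℝ) (next : Fin m → GameTree N S) (a : Fin m)
      (T : QueryTree N D S) : Simulates s E (next a) T → Simulates s E (.chance m w next) T
  | skip (E : ∀ i, Set (D i)) (i : N) (I m : ℕ) (next : Fin m → GameTree N S) (a : Fin m)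
      (T : QueryTree N D S) : (∀ t ∈ E i, s i t I = a) → Simulates s E (next a) T →
      Simulates s E (.decision i I m next) T
  | ask (E : ∀ i, Set (D i)) (i : N) (I m : ℕ) (next : Fin m → GameTree N S) (m' : ℕ)
      (act : Fin m' → Fin m) (part : Fin m' → Set (D i)) (child : Fin m' → QueryTree N D S) :
      Function.Injective act → (∀ x t, t ∈ part x ↔ t ∈ E i ∧ s i t I = act x) →
      (∀ t ∈ E i, ∃ x, t ∈ part x) →
      (∀ x, Simulates s (Function.update E i (part x)) (next (act x)) (child x)) →
      Simulates s E (.decision i I m next) (.query i m' part child)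

theorem forall_mem_update {E : ∀ i, Set (D i)} {i : N} {P : Set (D i)} {b : ∀ i, D i}
    (hb : ∀ j, b j ∈ E j) (hi : b i ∈ P) : ∀ j, b j ∈ Function.update E i P j := by
  intro l
  by_cases hl : l = i
  · subst hl; simpa using hi
  · simpa [hl] using hb l

theorem exists_simulates (s : ∀ i, D i → ℕ → ℕ) (G : GameTree N S) :
    (∀ i t h I m next, G.sub h = some (.decision i I m next) → s i t I < m) →
    (∀ h m w next, G.sub h = some (.chance m w next) → 0 < m) →
    ∀ E : ∀ i, Set (D i), (∀ i, (E i).Nonempty) →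
      ∃ T, Simulates s E G T ∧ T.IsRoundTableOn E := by
  induction G with
  | terminal X p => exact fun _ _ E _ => ⟨_, .terminal E X p, trivial⟩
  | chance m w next ih =>
    intro hs hc E hE
    have hm := hc [] m w next rfl
    -- Any branch would do; the first one is kept.
    obtain ⟨T, h1, h2⟩ := ih ⟨0, hm⟩
      (fun i t h I m' n' e => hs i t (0 :: h) I m' n' (by simpa [GameTree.sub, hm] using e))
      (fun h m' w' n' e => hc (0 :: h) m' w' n' (by simpa [GameTree.sub, hm] using e)) E hE
    exact ⟨T, .chance E m w next _ T h1, h2⟩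
  | decision i I m next ih =>
    intro hs hc E hE
    have hlt : ∀ t, s i t I < m := fun t => hs i t [] I m next rfl
    have ih' := fun a : Fin m => ih a
      (fun j t h J m' n' e => hs j t (a :: h) J m' n' (by simpa [GameTree.sub] using e))
      (fun h m' w' n' e => hc (a :: h) m' w' n' (by simpa [GameTree.sub] using e))
    let A : Finset (Fin m) := Finset.univ.filter fun a => ∃ t ∈ E i, s i t I = a
    have hA : ∀ t ∈ E i, ⟨s i t I, hlt t⟩ ∈ A := by
      intro t ht
      simp only [A, Finset.mem_filter, Finset.mem_univ, true_and]
      exact ⟨t, ht, rfl⟩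
    -- `A` holds the actions used by current types. A single one would give a query with only one
    -- subdomain, which is not allowed, so the decision is skipped.
    by_cases h1 : A.card ≤ 1
    · obtain ⟨t, ht⟩ := hE i
      obtain ⟨T, h2, h3⟩ := ih' ⟨s i t I, hlt t⟩ E hE
      refine ⟨T, .skip E i I m next _ T (fun t' ht' => ?_) h2, h3⟩
      exact congrArg Fin.val (Finset.card_le_one.1 h1 _ (hA t' ht') _ (hA t ht))
    · let e := A.equivFin.symm
      let part : Fin A.card → Set (D i) := fun x => {t | t ∈ E i ∧ s i t I = (e x : Fin m)}
      have hne : ∀ x, (part x).Nonempty := by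
        intro x
        have := (e x).2
        simp only [A, Finset.mem_filter, Finset.mem_univ, true_and] at this
        exact this
      have hE' : ∀ x l, (Function.update E i (part x) l).Nonempty := by
        intro x l
        by_cases hl : l = i
        · subst hl; simpa using hne x
        · simpa [hl] using hE l
      choose child hc1 hc2 using fun x => ih' (e x) _ (hE' x)
      have hinj : Function.Injective fun x => (e x : Fin m) :=
        Subtype.val_injective.comp e.injective
      have hcov : ∀ t ∈ E i, ∃ x, t ∈ part x :=
        fun t ht => ⟨e.symm ⟨_, hA t ht⟩, ht, by simp⟩
      refine ⟨.query i A.card part child, .ask E i I m next _ (fun x => (e x : Fin m)) part child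
        hinj (fun x t => Iff.rfl) hcov hc1, by omega, hne, ?_, ?_, hc2⟩
      · intro x y hxy
        refine Set.disjoint_left.2 fun t h2 h3 => hxy (hinj (Fin.ext ?_))
        exact h2.2.symm.trans h3.2
      · ext t
        rw [Set.mem_iUnion]
        exact ⟨fun ⟨x, h, _⟩ => h, hcov t⟩

namespace Simulates

variable {s : ∀ i, D i → ℕ → ℕ}

theorem mem_plays {E : ∀ i, Set (D i)} {G : GameTree N S} {T : QueryTree N D S}
    (h : Simulates s E G T) {b : ∀ i, D i} (hb : ∀ i, b i ∈ E i) {X : S} {p : N → ℝ}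
    (hr : T.Result b X p) : (X, p) ∈ GameTree.plays (fun i => s i (b i)) G := by
  induction h with
  | terminal E X' p' =>
    obtain ⟨l, h1, -⟩ := hr
    cases l with
    | nil =>
      simp only [QueryTree.sub, Option.some.injEq] at h1
      cases h1
      simp [GameTree.plays]
    | cons x l => simp [QueryTree.sub] at h1
  | chance E m w next a T _ ih => exact ⟨a, ih hb hr⟩
  | skip E i I m next a T h1 _ ih => exact ⟨a, (h1 _ (hb i)).symm, ih hb hr⟩
  | ask E i I m next m' act part child hinj hpart hcov _ ih =>
    obtain ⟨l, h1, h2⟩ := hr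
    cases l with
    | nil => simp [QueryTree.sub] at h1
    | cons x l =>
      obtain ⟨hx, hbx, h2⟩ := h2
      simp only [QueryTree.sub, hx, dif_pos] at h1
      exact ⟨act ⟨x, hx⟩, ((hpart _ _).1 hbx).2.symm,
        ih ⟨x, hx⟩ (forall_mem_update hb hbx) ⟨l, h1, h2⟩⟩

/-- As long as budget remains, `a` answers every query on the path of `b` as `b` does, so the moves
of `i` on it are those prescribed for `a i`. Once the budget is spent, `a` may leave the current
domains, whence the condition `k ≠ 0`. -/
theorem mem_outcomes {E : ∀ i, Set (D i)} {G : GameTree N S} {T : QueryTree N D S}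
    (h : Simulates s E G T) {a b : ∀ i, D i} {i : N} {X : S} {p : N → ℝ} {l : List ℕ} :
    ∀ {k : ℕ∞}, (∀ j, b j ∈ E j) → (k ≠ 0 → ∀ j, a j ∈ E j) → T.sub l = some (.leaf X p) →
      T.Available b l →
      (∀ v, v <+: l → (T.queriesBefore i v : ℕ∞) < k → ¬ T.Diverge v a b) →
      (X, p) ∈ GameTree.outcomes i (s i (a i)) k G := by
  induction h generalizing l with
  | terminal E X' p' =>
    intro k _ _ h1 _ _
    cases l with
    | nil =>
      simp only [QueryTree.sub, Option.some.injEq] at h1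
      cases h1
      simp [GameTree.outcomes]
    | cons x l => simp [QueryTree.sub] at h1
  | chance E m w next c T _ ih =>
    intro k hb ha h1 h2 h3
    exact ⟨c, ih hb ha h1 h2 h3⟩
  | skip E j I m next c T hc _ ih =>
    intro k hb ha h1 h2 h3
    -- The game's budget may drop at a skipped decision while the tree's count does not, so
    -- non-divergence is assumed for more nodes than needed.
    have hk : (if j = i then k - 1 else k) ≤ k := by
      split_ifs
      · exact tsub_le_self
      · exact le_rfl
    refine ⟨c, ?_, ih hb (fun h => ha fun h0 => h ?_) h1 h2
      fun v hv hlt => h3 v hv (hlt.trans_le hk)⟩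
    · rintro rfl hk0
      exact (hc _ (ha hk0 j)).symm
    · rw [h0] at hk
      exact h0 ▸ nonpos_iff_eq_zero.1 hk
  | ask E j I m next m' act part child hinj hpart hcov _ ih =>
    intro k hb ha h1 h2 h3
    cases l with
    | nil => simp [QueryTree.sub] at h1
    | cons x l =>
      obtain ⟨hx, hbx, h2⟩ := h2
      simp only [QueryTree.sub, hx, dif_pos] at h1
      -- A different answer of `a` would be a divergence at the root, which the positive budget
      -- excludes.
      have hroot : k ≠ 0 → a j ∈ part ⟨x, hx⟩ := by
        intro hk
        obtain ⟨y, hy⟩ := hcov _ (ha hk j)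
        by_contra hne
        refine h3 [] List.nil_prefix (by simpa [QueryTree.queriesBefore_nil, pos_iff_ne_zero])
          ⟨y, x, ?_, ⟨y.2, hy, ?_⟩, ⟨hx, hbx, ?_⟩⟩
        · intro hyx
          obtain rfl : y = ⟨x, hx⟩ := Fin.ext hyx
          exact hne hy
        · cases child y <;> trivial
        · cases child ⟨x, hx⟩ <;> trivial
      have hk : ∀ n : ℕ, (n : ℕ∞) < (if j = i then k - 1 else k) →
          (((if j = i then 1 else 0) + n : ℕ) : ℕ∞) < k := by
        intro n hn
        by_cases hj : j = i
        · simp only [hj, if_true, Nat.cast_add, Nat.cast_one] at hn ⊢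
          exact lt_tsub_iff_left.1 hn
        · simpa [hj] using hn
      refine ⟨act ⟨x, hx⟩, ?_, ih ⟨x, hx⟩ (forall_mem_update hb hbx) (fun h => ?_) h1 h2 ?_⟩
      · rintro rfl hk0
        exact ((hpart _ _).1 (hroot hk0)).2.symm
      · have hk0 : k ≠ 0 := by
          rintro rfl
          simp at h
        exact forall_mem_update (ha hk0) (hroot hk0)
      · rintro v hv hlt ⟨y, z, hyz, hay, hbz⟩
        have hk0 : k ≠ 0 := by
          rintro rfl
          simp at hlt
        refine h3 (x :: v) (List.cons_prefix_cons.2 ⟨rfl, hv⟩) ?_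
          ⟨y, z, hyz, ⟨hx, hroot hk0, hay⟩, ⟨hx, hbx, hbz⟩⟩
        simpa only [QueryTree.queriesBefore, hx, dif_pos] using hk _ hlt

/-- Each query comes from one history `g` of the game, the same for all profiles available there;
this puts diverging profiles on a common path of play. -/
theorem exists_history {E : ∀ i, Set (D i)} {G : GameTree N S} {T : QueryTree N D S}
    (h : Simulates s E G T) {i : N} {m' : ℕ} {part : Fin m' → Set (D i)}
    {child : Fin m' → QueryTree N D S} {u : List ℕ} (hu : T.sub u = some (.query i m' part child)) :
    ∃ g I m next, G.sub g = some (.decision i I m next) ∧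
      ∃ (E' : ∀ i, Set (D i)) (act : Fin m' → Fin m),
      Simulates s E' (.decision i I m next) (.query i m' part child) ∧
      Function.Injective act ∧ (∀ x t, t ∈ part x → s i t I = act x) ∧
      ∀ b : ∀ i, D i, (∀ j, b j ∈ E j) → T.Available b u →
        (∀ j, b j ∈ E' j) ∧ ∀ j, G.Follows j (s j (b j)) g := by
  induction h generalizing u with
  | terminal E X' p' => cases u <;> simp [QueryTree.sub] at hu
  | chance E m w next c T _ ih =>
    obtain ⟨g, I, m1, next1, hg, E', act, h1, h2, h3, h4⟩ := ih hu
    refine ⟨c :: g, I, m1, next1, by rw [GameTree.sub_chance, hg], E', act, h1, h2, h3,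
      fun b hb hbu => ⟨(h4 b hb hbu).1, fun j => ?_⟩⟩
    refine GameTree.follows_cons (GameTree.sub_chance m w next c) ?_ ((h4 b hb hbu).2 j)
    rintro J ⟨m2, next2, h5⟩
    simp [GameTree.sub] at h5
  | skip E j I m next c T hc _ ih =>
    obtain ⟨g, I1, m1, next1, hg, E', act, h1, h2, h3, h4⟩ := ih hu
    refine ⟨c :: g, I1, m1, next1, by rw [GameTree.sub_decision, hg], E', act, h1, h2, h3,
      fun b hb hbu => ⟨(h4 b hb hbu).1, fun l => ?_⟩⟩
    refine GameTree.follows_cons (GameTree.sub_decision j I m next c) ?_ ((h4 b hb hbu).2 l)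
    rintro J ⟨m2, next2, h5⟩
    simp only [GameTree.sub, Option.some.injEq] at h5
    cases h5
    exact (hc _ (hb _)).symm
  | ask E j I m next m1 act1 part1 child1 hinj hpart hcov hsim ih =>
    cases u with
    | nil =>
      simp only [QueryTree.sub, Option.some.injEq] at hu
      cases hu
      exact ⟨[], I, m, next, rfl, E, act1, .ask E i I m next _ act1 _ _ hinj hpart hcov hsim,
        hinj, fun x t ht => ((hpart x t).1 ht).2,
        fun b hb _ => ⟨hb, fun j => GameTree.follows_nil _ _ _⟩⟩
    | cons x u =>
      by_cases hx : x < m1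
      swap
      · simp [QueryTree.sub, hx] at hu
      simp only [QueryTree.sub, hx, dif_pos] at hu
      obtain ⟨g, I1, m2, next2, hg, E', act, h1, h2, h3, h4⟩ := ih ⟨x, hx⟩ hu
      refine ⟨act1 ⟨x, hx⟩ :: g, I1, m2, next2, by rw [GameTree.sub_decision, hg], E', act, h1, h2,
        h3, ?_⟩
      rintro b hb ⟨_, hbx, hbu⟩
      have h5 := h4 b (forall_mem_update hb hbx) hbu
      refine ⟨h5.1, fun l => ?_⟩
      refine GameTree.follows_cons (GameTree.sub_decision j I m next _) ?_ (h5.2 l)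
      rintro J ⟨m3, next3, h6⟩
      simp only [GameTree.sub, Option.some.injEq] at h6
      cases h6
      exact ((hpart _ _).1 hbx).2.symm

theorem kStepOSP {M : Mechanism N D S} {T : QueryTree N D S} {cost : ∀ i, D i → S → ℝ} {k : ℕ∞}
    (h : Simulates M.strategy (fun _ => Set.univ) M.game T) (hT : T.IsRoundTable)
    (hM : M.KStepOSP cost k) : T.KStepOSP cost k := by
  rintro i u ⟨m', part, child, hu⟩ a b c hau ⟨hbu, -, hab⟩ ⟨x, y, hxy, hax, hcy⟩ X p X' p' hb hc
  obtain ⟨g, I, m, next, hg, E, act, hsim, hinj, hact, hE⟩ := h.exists_history hu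
  rw [QueryTree.available_append hu] at hax hcy
  obtain ⟨-, hx, hax, -⟩ := hax
  obtain ⟨hcu, hy, hcy, -⟩ := hcy
  obtain ⟨haE, haF⟩ := hE a (fun _ => trivial) hau
  obtain ⟨hbE, -⟩ := hE b (fun _ => trivial) hbu
  obtain ⟨hcE, hcF⟩ := hE c (fun _ => trivial) hcu
  have hI : M.game.InInfoSet i I g := ⟨m, next, hg⟩
  refine hM i (a i) (M.strategy i (c i)) (M.isStrategy i (c i)) I
    ⟨⟨g, hI, haF i⟩, ⟨g, hI, hcF i⟩, ?_, ?_⟩ (X, p) ?_ (X', p') ?_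
  -- `J` may precede `I` along another history `g₂`. By perfect recall `g` has the same record, so
  -- `J` was met on `g`, where both strategies took the recorded action.
  · rintro J ⟨g₁, g₂, hJ, hI₂, ⟨v, rfl⟩, hne⟩
    cases v with
    | nil => simp at hne
    | cons z v =>
      have h1 : (J, z) ∈ GameTree.record i M.game (g₁ ++ z :: v) :=
        GameTree.mem_record.2 ⟨g₁, ⟨v, by simp⟩, hJ⟩
      rw [M.isGame.perfect_recall i I _ _ hI₂ hI] at h1
      obtain ⟨g₃, h2, h3⟩ := GameTree.mem_record.1 h1
      exact (haF i g₃ z J h2 h3).symm.trans (hcF i g₃ z J h2 h3)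
  · rw [hact _ _ hax, hact _ _ hcy]
    exact fun he => hxy (congrArg Fin.val (hinj (Fin.ext he)))
  · obtain ⟨l, hl, hbl⟩ := hb.sub hT hu hbu
    refine GameTree.mem_outcomesFrom_iff.2 ⟨g, m, next, hg,
      hsim.mem_outcomes hbE (fun _ => haE) hl hbl fun v hv hlt hdiv => ?_⟩
    refine hab (u ++ v) (QueryTree.inNeighborhood_of_queriesBefore_lt hu
      ⟨m', part, child, rfl⟩ hl hv hlt) ?_
    rwa [QueryTree.diverge_append hu hau hbu]
  · exact GameTree.mem_outcomesFrom_iff.2 ⟨g, m, next, hg,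
      GameTree.plays_subset_outcomes i (fun j => M.strategy j (c j)) _ _ _
        (hsim.mem_plays hcE (hc.sub hT hu hcu))⟩

theorem implements {M : Mechanism N D S} {T : QueryTree N D S} {f : (∀ i, D i) → S}
    (h : Simulates M.strategy (fun _ => Set.univ) M.game T) (hT : T.IsRoundTable)
    (hM : M.Implements f) : T.Implements f := by
  intro b
  obtain ⟨X, p, hr⟩ := QueryTree.IsRoundTableOn.exists_result (b := b) hT fun _ => trivial
  have hX : X = f b := hM b _ (h.mem_plays (fun _ => trivial) hr)
  exact ⟨p, hX ▸ hr⟩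

end Simulates

/-- An empty sum of probabilities would be zero. -/
theorem GameTree.IsGame.chance_pos {G : GameTree N S} (hG : G.IsGame) {h : List ℕ} {m : ℕ}
    {w : Fin m → ℝ} {next : Fin m → GameTree N S} (hs : G.sub h = some (.chance m w next)) :
    0 < m := by
  rcases Nat.eq_zero_or_pos m with rfl | hm
  · simpa using hG.prob_sum h 0 w next hs
  · exact hm

/-! ### Games and trees without moves, for empty domains -/

/-- The mechanism that ends at once with outcome `X` and without payments. -/
def constantMechanism (N : Type*) (D : N → Type*) {S : Type*} (X : S) : Mechanism N D S where
  game := .terminal X 0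
  isGame := by
    have h0 : ∀ (h : List ℕ) (G : GameTree N S),
        (GameTree.terminal X 0 : GameTree N S).sub h = some G → G = .terminal X 0 := by
      intro h G hs
      cases h <;> simp_all [GameTree.sub]
    refine ⟨?_, ?_, ?_, ?_, ?_⟩
    · intro h i I m next hs
      exact absurd (h0 _ _ hs) (by simp)
    · intro h m w next hs
      exact absurd (h0 _ _ hs) (by simp)
    · intro h m w next hs
      exact absurd (h0 _ _ hs) (by simp)
    · intro h h' i I m m' next next' hs
      exact absurd (h0 _ _ hs) (by simp)
    · rintro i I h h' ⟨m, next, hs⟩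
      exact absurd (h0 _ _ hs) (by simp)
  strategy := fun _ _ _ => 0
  isStrategy := by
    intro i t h I m next hs
    cases h <;> simp [GameTree.sub] at hs

theorem constantMechanism_kStepOSP (X : S) (cost : ∀ i, D i → S → ℝ) (k : ℕ∞) :
    (constantMechanism N D X).KStepOSP cost k := by
  rintro i t σ' - I ⟨⟨h, ⟨m, next, hs⟩, -⟩, -⟩
  cases h <;> simp [constantMechanism, GameTree.sub] at hs

theorem leaf_kStepOSP (X : S) (p : N → ℝ) (cost : ∀ i, D i → S → ℝ) (k : ℕ∞) :
    (QueryTree.leaf X p : QueryTree N D S).KStepOSP cost k := by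
  rintro i u ⟨m, part, child, hs⟩
  cases u <;> simp [QueryTree.sub] at hs

end

end OSP

theorem mainTheorem7 {N : Type*} [Finite N] {D : N → Type*} {S : Type*}
    (cost : ∀ i, D i → S → ℝ) (f : (∀ i, D i) → S) (k : ℕ∞) :
    (∃ M : OSP.Mechanism N D S, M.KStepOSP cost k ∧ M.Implements f) ↔
      (∃ T : OSP.QueryTree N D S, T.IsRoundTable ∧ T.KStepOSP cost k ∧ T.Implements f) := by
  by_cases hD : ∀ i, Nonempty (D i)
  · constructor
    · rintro ⟨M, hM, hf⟩
      obtain ⟨T, hsim, hT⟩ := OSP.exists_simulates M.strategy M.game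
        (fun i t h I m next hs => M.isStrategy i t h I m next hs)
        (fun h m w next hs => M.isGame.chance_pos hs) (fun _ => Set.univ)
        (fun i => Set.univ_nonempty)
      exact ⟨T, hT, hsim.kStepOSP hT hM, hsim.implements hT hf⟩
    · rintro ⟨T, hT, hk, hf⟩
      exact ⟨T.toMechanism hT hD, hk.toMechanism hT hD, hf.toMechanism hT hD⟩
  -- Implementation is vacuous, but a leaf still needs some outcome; it is taken from the given
  -- mechanism or tree.
  · have hempty : (∀ i, D i) → False := fun b => hD fun i => ⟨b i⟩
    constructor
    · rintro ⟨M, -, -⟩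
      obtain ⟨X⟩ := M.game.nonempty_outcome M.isGame.action_exists
        (fun h m w next hs => M.isGame.chance_pos hs)
      exact ⟨.leaf X 0, trivial, OSP.leaf_kStepOSP X 0 cost k, fun b => (hempty b).elim⟩
    · rintro ⟨T, hT, -, -⟩
      obtain ⟨X⟩ := OSP.QueryTree.IsRoundTableOn.nonempty_outcome hT
      exact ⟨OSP.constantMechanism N D X, OSP.constantMechanism_kStepOSP X cost k,
        fun b => (hempty b).elim⟩
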